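/- Let $\mathbb Z_2$ be the dyadic integers with their Borel $\sigma$-algebra. Form the graph $\Lambda$ on the vertex set $\mathbb Z\times\mathbb Z_2$ in which $(m,b)$ is joined by an edge to $(m,b+1)$, to $(m,b-1)$ and to $(m+1,2b)$, for all $m\in\mathbb Z$ and $b\in\mathbb Z_2$, and in which there are no other edges. For $a\in\mathbb Z_2$ let $\Gamma_a$ be the connected component of $(0,a)$ in $\Lambda$, with root $(0,a)$, and identify the space of rooted graphs $\{\Gamma_a : a\in\mathbb Z_2\}$ with $\mathbb Z_2$. Simple random walk on this space moves from $\Gamma_a$ to $\Gamma_b$, where $(m,b)$ is a uniformly random neighbour of the root $(0,a)$ in $\Gamma_a$; that is, from $a$ the walk moves to $a+1$, $a-1$, $2a$ or, if $a$ is even, $a/2$, where the three or four moves are equally likely. A stationary measure for simple random walk is a Borel probability measure on $\mathbb Z_2$ that is invariant under this Markov chain. Then there is a unique stationary measure $\nu_{\mathrm s}$ for simple random walk. Furthermore, $\nu_{\mathrm s}$ is continuous, that is, $\nu_{\mathrm s}(\{a\})=0$ for every $a\in\mathbb Z_2$. -/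

import Mathlib

open MeasureTheory ProbabilityTheory

/-- The dyadic integers carry their Borel sigma-algebra. -/
noncomputable instance dyadicMeasurableSpace : MeasurableSpace ℤ_[2] := borel ℤ_[2]

instance dyadicBorelSpace : BorelSpace ℤ_[2] := ⟨rfl⟩

theorem dyadic_two_mul_injective : Function.Injective (fun b : ℤ_[2] => 2 * b) :=
  mul_right_injective₀ two_ne_zero

/-- The disconnected graph on `ℤ × ℤ₂`. A vertex `(m, b)` has depth `m`. Horizontal edges join
`(m, b)` to `(m, b ± 1)`; vertical edges join `(m, b)` to `(m + 1, 2 * b)`, where `2 * b` is `b`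
with the digit `0` appended on the right. -/
def dyadicLattice : SimpleGraph (ℤ × ℤ_[2]) where
  Adj v w :=
    (v.1 = w.1 ∧ (w.2 = v.2 + 1 ∨ w.2 = v.2 - 1)) ∨
    (w.1 = v.1 + 1 ∧ w.2 = 2 * v.2) ∨ (v.1 = w.1 + 1 ∧ v.2 = 2 * w.2)
  symm := ⟨by
    rintro v w (⟨h, h' | h'⟩ | h | h)
    · exact Or.inl ⟨h.symm, Or.inr (by rw [h']; ring)⟩
    · exact Or.inl ⟨h.symm, Or.inl (by rw [h']; ring)⟩
    · exact Or.inr (Or.inr h)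
    · exact Or.inr (Or.inl h)⟩
  loopless := ⟨by
    rintro v (⟨-, h | h⟩ | ⟨h, -⟩ | ⟨h, -⟩)
    · simp at h
    · have : (1 : ℤ_[2]) = 0 := by linear_combination h
      exact one_ne_zero this
    · omega
    · omega⟩

/-- The vertices of `Γ a`: the connected component of `(0, a)`. -/
abbrev GammaVertex (a : ℤ_[2]) : Type :=
  ↥(dyadicLattice.connectedComponentMk (0, a))

/-- The graph `Γ a`: the connected component of `(0, a)` in the dyadic lattice. -/
def Gamma (a : ℤ_[2]) : SimpleGraph (GammaVertex a) :=
  (dyadicLattice.connectedComponentMk (0, a)).toSimpleGraph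

/-- The root `(0, a)` of `Γ a`. -/
def gammaRoot (a : ℤ_[2]) : GammaVertex a :=
  ⟨(0, a), SimpleGraph.ConnectedComponent.connectedComponentMk_mem⟩

/-- One step of simple random walk on `Γ a` from its root, projected to `ℤ₂` by `(m, b) ↦ b`:
the root is moved to a uniformly random neighbour. -/
noncomputable def gammaStep (a : ℤ_[2]) : Measure ℤ_[2] :=
  (uniformOn ((Gamma a).neighborSet (gammaRoot a))).map (fun v => v.1.2)

/-- Deleting a terminal digit `0`, with value `0` on odd dyadic integers. -/
noncomputable def dyadicHalf : ℤ_[2] → ℤ_[2] :=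
  Function.extend (fun b => 2 * b) id (fun _ => 0)

theorem dyadicHalf_two_mul (b : ℤ_[2]) : dyadicHalf (2 * b) = b :=
  dyadic_two_mul_injective.extend_apply id _ b

theorem dyadic_two_mul_measurableEmbedding :
    MeasurableEmbedding (fun b : ℤ_[2] => 2 * b) :=
  ((by fun_prop : Continuous (fun b : ℤ_[2] => 2 * b)).isClosedEmbedding
    dyadic_two_mul_injective).measurableEmbedding

theorem measurable_dyadicHalf : Measurable dyadicHalf :=
  dyadic_two_mul_measurableEmbedding.measurable_extend measurable_id measurable_const

theorem gammaRoot_adj (a : ℤ_[2]) {v : ℤ × ℤ_[2]} (hv : dyadicLattice.Adj (0, a) v) :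
    ∃ w : GammaVertex a, w.1 = v ∧ w ∈ (Gamma a).neighborSet (gammaRoot a) :=
  ⟨⟨v, (SimpleGraph.ConnectedComponent.eq.2 hv.reachable.symm :)⟩, rfl, hv⟩

/-- The law of a uniform point of a finite set of vertices, projected to `ℤ₂`. -/
theorem map_uniformOn_finset (a : ℤ_[2]) (s : Finset (GammaVertex a)) (B : Set ℤ_[2])
    (hB : MeasurableSet B) :
    (uniformOn (s : Set (GammaVertex a))).map (fun v => v.1.2) B =
      (s.card : ENNReal)⁻¹ * ∑ v ∈ s, B.indicator 1 v.1.2 := by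
  have hm : Measurable (fun v : GammaVertex a => v.1.2) :=
    measurable_snd.comp measurable_subtype_coe
  classical
  rw [Measure.map_apply hm hB, uniformOn, cond_apply s.measurableSet, Measure.count_apply_finset,
    Set.inter_comm, ← Measure.restrict_apply (hm hB), ← lintegral_indicator_one (hm hB),
    lintegral_finset]
  simp [Set.indicator_apply]

/-- From an odd `a` the walk moves to `a + 1`, `a - 1`, `2 * a` with probability `1 / 3` each. -/
theorem gammaStep_odd (a : ℤ_[2]) (ha : a ∉ Set.range (fun b : ℤ_[2] => 2 * b))
    (B : Set ℤ_[2]) (hB : MeasurableSet B) :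
    gammaStep a B = 3⁻¹ * (B.indicator 1 (a + 1) + B.indicator 1 (a - 1)
      + B.indicator 1 (2 * a)) := by
  classical
  obtain ⟨r, hr, hr'⟩ := gammaRoot_adj a (v := (0, a + 1)) (Or.inl ⟨rfl, Or.inl rfl⟩)
  obtain ⟨l, hl, hl'⟩ := gammaRoot_adj a (v := (0, a - 1)) (Or.inl ⟨rfl, Or.inr rfl⟩)
  obtain ⟨d, hd, hd'⟩ := gammaRoot_adj a (v := (1, 2 * a)) (Or.inr (Or.inl ⟨by simp, rfl⟩))
  have hset : (Gamma a).neighborSet (gammaRoot a) = (({r, l, d} : Finset _) : Set _) := by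
    ext w
    simp only [Finset.coe_insert, Finset.coe_singleton, Set.mem_insert_iff, Set.mem_singleton_iff]
    constructor
    · rintro (⟨h, h' | h'⟩ | ⟨h, h'⟩ | ⟨-, h⟩)
      · exact Or.inl (Subtype.ext (by rw [hr]; exact Prod.ext h.symm h'))
      · exact Or.inr (Or.inl (Subtype.ext (by rw [hl]; exact Prod.ext h.symm h')))
      · exact Or.inr (Or.inr (Subtype.ext (by rw [hd]; exact Prod.ext (by simpa [gammaRoot] using h) h')))
      · exact absurd ⟨w.1.2, h.symm⟩ ha
    · rintro (rfl | rfl | rfl) <;> assumption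
  have h1 : r ≠ l := fun h => by
    rw [h, hl] at hr
    have := congrArg Prod.snd hr
    have h2 : (2 : ℤ_[2]) = 0 := by linear_combination -this
    exact two_ne_zero h2
  have h2 : r ≠ d := fun h => by rw [h, hd] at hr; simp at hr
  have h3 : l ≠ d := fun h => by rw [h, hd] at hl; simp at hl
  rw [gammaStep, hset, map_uniformOn_finset a _ B hB,
    Finset.sum_insert (by simp [h1, h2]), Finset.sum_insert (by simp [h3]), Finset.sum_singleton,
    Finset.card_insert_of_notMem (by simp [h1, h2]), Finset.card_insert_of_notMem (by simp [h3]),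
    Finset.card_singleton, hr, hl, hd]
  norm_num [add_assoc]

/-- From an even `a` the walk moves to `a + 1`, `a - 1`, `2 * a`, `a / 2` with probability
`1 / 4` each. -/
theorem gammaStep_even (a : ℤ_[2]) (ha : a ∈ Set.range (fun b : ℤ_[2] => 2 * b))
    (B : Set ℤ_[2]) (hB : MeasurableSet B) :
    gammaStep a B = 4⁻¹ * (B.indicator 1 (a + 1) + B.indicator 1 (a - 1)
      + B.indicator 1 (2 * a) + B.indicator 1 (dyadicHalf a)) := by
  classical
  obtain ⟨b, hb⟩ := ha
  have hb : a = 2 * b := hb.symm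
  have hhalf : dyadicHalf a = b := by rw [hb, dyadicHalf_two_mul]
  obtain ⟨r, hr, hr'⟩ := gammaRoot_adj a (v := (0, a + 1)) (Or.inl ⟨rfl, Or.inl rfl⟩)
  obtain ⟨l, hl, hl'⟩ := gammaRoot_adj a (v := (0, a - 1)) (Or.inl ⟨rfl, Or.inr rfl⟩)
  obtain ⟨d, hd, hd'⟩ := gammaRoot_adj a (v := (1, 2 * a)) (Or.inr (Or.inl ⟨by simp, rfl⟩))
  obtain ⟨u, hu, hu'⟩ := gammaRoot_adj a (v := (-1, b)) (Or.inr (Or.inr ⟨by simp, hb⟩))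
  have hset : (Gamma a).neighborSet (gammaRoot a) = (({r, l, d, u} : Finset _) : Set _) := by
    ext w
    simp only [Finset.coe_insert, Finset.coe_singleton, Set.mem_insert_iff, Set.mem_singleton_iff]
    constructor
    · rintro (⟨h, h' | h'⟩ | ⟨h, h'⟩ | ⟨h, h'⟩)
      · exact Or.inl (Subtype.ext (by rw [hr]; exact Prod.ext h.symm h'))
      · exact Or.inr (Or.inl (Subtype.ext (by rw [hl]; exact Prod.ext h.symm h')))
      · exact Or.inr (Or.inr (Or.inl (Subtype.ext
          (by rw [hd]; exact Prod.ext (by simpa [gammaRoot] using h) h'))))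
      · refine Or.inr (Or.inr (Or.inr (Subtype.ext ?_)))
        rw [hu]
        refine Prod.ext ?_ (dyadic_two_mul_injective ?_)
        · have h0 : (0 : ℤ) = w.1.1 + 1 := h
          show w.1.1 = -1
          omega
        · have h0 : a = 2 * w.1.2 := h'
          show 2 * w.1.2 = 2 * b
          rw [← h0, hb]
    · rintro (rfl | rfl | rfl | rfl) <;> assumption
  have h1 : r ≠ l := fun h => by
    rw [h, hl] at hr
    have := congrArg Prod.snd hr
    have h2 : (2 : ℤ_[2]) = 0 := by linear_combination -this
    exact two_ne_zero h2
  have h2 : r ≠ d := fun h => by rw [h, hd] at hr; simp at hr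
  have h3 : l ≠ d := fun h => by rw [h, hd] at hl; simp at hl
  have h4 : r ≠ u := fun h => by rw [h, hu] at hr; simp at hr
  have h5 : l ≠ u := fun h => by rw [h, hu] at hl; simp at hl
  have h6 : d ≠ u := fun h => by
    rw [h, hu] at hd
    have := congrArg Prod.fst hd
    norm_num at this
  rw [gammaStep, hset, map_uniformOn_finset a _ B hB,
    Finset.sum_insert (by simp [h1, h2, h4]), Finset.sum_insert (by simp [h3, h5]),
    Finset.sum_insert (by simp [h6]), Finset.sum_singleton,
    Finset.card_insert_of_notMem (by simp [h1, h2, h4]),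
    Finset.card_insert_of_notMem (by simp [h3, h5]),
    Finset.card_insert_of_notMem (by simp [h6]),
    Finset.card_singleton, hr, hl, hd, hu, hhalf]
  norm_num [add_assoc]

theorem measurable_gammaStep : Measurable gammaStep := by
  classical
  refine Measure.measurable_of_measurable_coe _ fun B hB => ?_
  have hi : Measurable (B.indicator (1 : ℤ_[2] → ENNReal)) := measurable_one.indicator hB
  have h1 : Measurable fun a : ℤ_[2] => B.indicator (1 : ℤ_[2] → ENNReal) (a + 1) :=
    hi.comp (by fun_prop : Continuous fun a : ℤ_[2] => a + 1).measurable
  have h2 : Measurable fun a : ℤ_[2] => B.indicator (1 : ℤ_[2] → ENNReal) (a - 1) :=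
    hi.comp (by fun_prop : Continuous fun a : ℤ_[2] => a - 1).measurable
  have h3 : Measurable fun a : ℤ_[2] => B.indicator (1 : ℤ_[2] → ENNReal) (2 * a) :=
    hi.comp dyadic_two_mul_measurableEmbedding.measurable
  have h4 : Measurable fun a : ℤ_[2] => B.indicator (1 : ℤ_[2] → ENNReal) (dyadicHalf a) :=
    hi.comp measurable_dyadicHalf
  have key : (fun a => gammaStep a B) = fun a =>
      if a ∈ Set.range (fun b : ℤ_[2] => 2 * b) then
        4⁻¹ * (B.indicator 1 (a + 1) + B.indicator 1 (a - 1)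
          + B.indicator 1 (2 * a) + B.indicator 1 (dyadicHalf a))
      else 3⁻¹ * (B.indicator 1 (a + 1) + B.indicator 1 (a - 1) + B.indicator 1 (2 * a)) := by
    funext a
    split_ifs with h
    · exact gammaStep_even a h B hB
    · exact gammaStep_odd a h B hB
  rw [key]
  exact Measurable.ite dyadic_two_mul_measurableEmbedding.measurableSet_range
    ((((h1.add h2).add h3).add h4).const_mul _) (((h1.add h2).add h3).const_mul _)

/-- The transition kernel of simple random walk on the space of rooted graphs `Γ a`, identified
with the dyadic integers through `a ↦ Γ a`. -/
noncomputable def gammaWalk : Kernel ℤ_[2] ℤ_[2] :=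
  ⟨gammaStep, measurable_gammaStep⟩

/-- A stationary measure for simple random walk: a probability measure on the dyadic integers
that is invariant under the induced walk. -/
def IsStationaryMeasure (ν : Measure ℤ_[2]) : Prop :=
  IsProbabilityMeasure ν ∧ gammaWalk.Invariant ν

/-! Let P be the averaging operator of the walk (`dyadicAvg`). It preserves C(ℤ₂), because halving
is continuous on the clopen set of even points. Everything rests on one fact: for continuous f, the
iterates Pⁿf come uniformly close to constants (`exists_dyadicAvg_pow_abs_sub_le`).

Two ingredients give it. The iterates are equicontinuous: coupled walks from points congruent mod
2^k make the same moves; doubling gains a digit of agreement, and only halving, possible only at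
even points, loses one. A parity-weighted Lipschitz condition shows that the gains outweigh the
losses (`WeightedLipschitz.dyadicAvg`). Moreover, from every start the walk lies in 2^k ℤ₂ at time
2^k with probability at least 4^(-2^k), and there an equicontinuous iterate is nearly constant; so
the oscillation keeps shrinking.

Integrating Pⁿf against two stationary measures gives uniqueness. A limit point of the laws of the
walk from 0 gives existence. For atoms, ν{y} divided by the degree of y is harmonic; a positive
maximum would spread to every x + n, giving infinitely many atoms of equal weighted mass. -/

/-! ### Parity and halving on the dyadic integers. -/

theorem mem_range_two_mul_iff (a : ℤ_[2]) :
    a ∈ Set.range (fun b : ℤ_[2] => 2 * b) ↔ 2 ∣ a :=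
  ⟨fun ⟨b, hb⟩ => ⟨b, hb.symm⟩, fun ⟨b, hb⟩ => ⟨b, hb.symm⟩⟩

theorem isClopen_range_two_mul : IsClopen (Set.range (fun b : ℤ_[2] => 2 * b)) := by
  have h : Set.range (fun b : ℤ_[2] => 2 * b) = Metric.ball 0 1 := by
    ext a
    rw [mem_range_two_mul_iff, mem_ball_zero_iff, PadicInt.norm_lt_one_iff_dvd]
    norm_cast
  refine ⟨((by fun_prop : Continuous (fun b : ℤ_[2] => 2 * b)).isClosedEmbedding
    dyadic_two_mul_injective).isClosed_range, ?_⟩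
  rw [h]
  exact Metric.isOpen_ball

/-- Even and odd points form clopen sets, so the default value 0 at odd points does no harm. -/
theorem continuous_dyadicHalf : Continuous dyadicHalf := by
  have hemb := (by fun_prop : Continuous (fun b : ℤ_[2] => 2 * b)).isClosedEmbedding
    dyadic_two_mul_injective
  have hop : Topology.IsOpenEmbedding (fun b : ℤ_[2] => 2 * b) :=
    ⟨hemb.isEmbedding, isClopen_range_two_mul.isOpen⟩
  rw [continuous_iff_continuousAt]
  intro a
  by_cases ha : a ∈ Set.range (fun b : ℤ_[2] => 2 * b)
  · obtain ⟨b, rfl⟩ := ha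
    rw [hop.continuousAt_iff.symm]
    have : dyadicHalf ∘ (fun b : ℤ_[2] => 2 * b) = id := funext dyadicHalf_two_mul
    rw [this]
    exact continuousAt_id
  · have hev : dyadicHalf =ᶠ[nhds a] fun _ => 0 := by
      filter_upwards [isClopen_range_two_mul.compl.isOpen.mem_nhds ha] with x hx
      exact Function.extend_apply' _ _ _ hx
    exact continuousAt_const.congr hev.symm

/-! ### The averaging operator on continuous functions. -/

open Classical in
/-- The averaging operator of simple random walk, acting on continuous functions. -/
noncomputable def dyadicAvg : C(ℤ_[2], ℝ) →ₗ[ℝ] C(ℤ_[2], ℝ) where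
  toFun f :=
    ⟨fun a => if a ∈ Set.range (fun b : ℤ_[2] => 2 * b) then
        (f (a + 1) + f (a - 1) + f (2 * a) + f (dyadicHalf a)) / 4
      else (f (a + 1) + f (a - 1) + f (2 * a)) / 3, by
      have := continuous_dyadicHalf
      refine continuous_if (fun a ha => ?_) ?_ ?_
      · have := isClopen_range_two_mul.frontier_eq
        simp only [Set.ofPred_mem_eq, this] at ha
        exact ha.elim
      · fun_prop
      · fun_prop⟩
  map_add' f g := by
    ext a
    simp only [ContinuousMap.coe_mk, ContinuousMap.add_apply]
    split_ifs <;> ring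
  map_smul' c f := by
    ext a
    simp only [ContinuousMap.coe_mk, ContinuousMap.smul_apply, RingHom.id_apply, smul_eq_mul]
    split_ifs <;> ring

theorem dyadicAvg_two_mul (f : C(ℤ_[2], ℝ)) (b : ℤ_[2]) :
    dyadicAvg f (2 * b) = (f (2 * b + 1) + f (2 * b - 1) + f (2 * (2 * b)) + f b) / 4 := by
  simp [dyadicAvg, dyadicHalf_two_mul]

theorem dyadicAvg_of_not_dvd (f : C(ℤ_[2], ℝ)) {a : ℤ_[2]} (ha : ¬ 2 ∣ a) :
    dyadicAvg f a = (f (a + 1) + f (a - 1) + f (2 * a)) / 3 := by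
  rw [← mem_range_two_mul_iff] at ha
  simp only [dyadicAvg, LinearMap.coe_mk, AddHom.coe_mk, ContinuousMap.coe_mk, if_neg ha]

theorem two_dvd_or_two_dvd_add_one (a : ℤ_[2]) : 2 ∣ a ∨ 2 ∣ a + 1 := by
  have h := PadicInt.appr_spec 1 a
  rw [Ideal.mem_span_singleton] at h
  norm_num at h
  rcases Nat.even_or_odd' (a.appr 1) with ⟨c, hc | hc⟩
  · left
    have := dvd_add h (Dvd.intro (c : ℤ_[2]) rfl)
    rw [hc] at this
    push_cast at this
    simpa using this
  · right
    have := dvd_add h (Dvd.intro (c + 1 : ℤ_[2]) rfl)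
    rw [hc] at this
    push_cast at this
    convert this using 1
    ring

theorem not_two_dvd_one : ¬ (2 : ℤ_[2]) ∣ 1 := by
  have := PadicInt.norm_lt_one_iff_dvd (p := 2) 1
  intro h
  have h' := this.2 (by exact_mod_cast h)
  simp at h'

theorem not_two_dvd_iff (a : ℤ_[2]) : ¬ 2 ∣ a ↔ 2 ∣ a + 1 :=
  ⟨(two_dvd_or_two_dvd_add_one a).resolve_left,
    fun h h' => not_two_dvd_one ((dvd_add_right h').1 h)⟩

theorem dyadicAvg_le {f : C(ℤ_[2], ℝ)} {s : ℝ} (h : ∀ a, f a ≤ s) (a : ℤ_[2]) :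
    dyadicAvg f a ≤ s := by
  by_cases ha : 2 ∣ a
  · obtain ⟨b, rfl⟩ := ha
    rw [dyadicAvg_two_mul]
    linarith [h (2 * b + 1), h (2 * b - 1), h (2 * (2 * b)), h b]
  · rw [dyadicAvg_of_not_dvd f ha]
    linarith [h (a + 1), h (a - 1), h (2 * a)]

theorem dyadicAvg_pow_succ (n : ℕ) (f : C(ℤ_[2], ℝ)) :
    (dyadicAvg ^ (n + 1)) f = dyadicAvg ((dyadicAvg ^ n) f) := by
  rw [pow_succ']
  rfl

theorem dyadicAvg_pow_le {f : C(ℤ_[2], ℝ)} {s : ℝ} (h : ∀ a, f a ≤ s) (n : ℕ) (a : ℤ_[2]) :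
    (dyadicAvg ^ n) f a ≤ s := by
  induction n generalizing a with
  | zero => exact h a
  | succ n ih =>
    rw [dyadicAvg_pow_succ]
    exact dyadicAvg_le ih a

theorem le_dyadicAvg_pow {f : C(ℤ_[2], ℝ)} {s : ℝ} (h : ∀ a, s ≤ f a) (n : ℕ) (a : ℤ_[2]) :
    s ≤ (dyadicAvg ^ n) f a := by
  have := dyadicAvg_pow_le (f := -f) (s := -s) (fun a => neg_le_neg (h a)) n a
  rw [map_neg, ContinuousMap.neg_apply] at this
  exact neg_le_neg_iff.1 this

/-! ### Equicontinuity of the iterates. -/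

/-- `g` is Lipschitz up to `ε` for a dyadic pseudometric weighted by parity, and oscillates by
at most `M`. The weights are chosen so that averaging preserves this. -/
structure WeightedLipschitz (ε L M : ℝ) (g : C(ℤ_[2], ℝ)) : Prop where
  osc_le : ∀ a b, |g a - g b| ≤ M
  of_even : ∀ k a b, 2 ∣ a → 2 ^ k ∣ a - b → |g a - g b| ≤ ε + L * (3 / 4) ^ k
  of_odd : ∀ k a b, ¬ 2 ∣ a → 2 ^ k ∣ a - b → |g a - g b| ≤ ε + L * (3 / 4) ^ k * (11 / 12)

theorem abs_avg_four_le {x₁ x₂ x₃ x₄ y₁ y₂ y₃ y₄ r₁ r₂ r₃ r₄ r : ℝ} (h₁ : |x₁ - y₁| ≤ r₁)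
    (h₂ : |x₂ - y₂| ≤ r₂) (h₃ : |x₃ - y₃| ≤ r₃) (h₄ : |x₄ - y₄| ≤ r₄)
    (h : (r₁ + r₂ + r₃ + r₄) / 4 ≤ r) :
    |(x₁ + x₂ + x₃ + x₄) / 4 - (y₁ + y₂ + y₃ + y₄) / 4| ≤ r := by
  rw [abs_le] at *
  constructor <;> linarith

theorem abs_avg_three_le {x₁ x₂ x₃ y₁ y₂ y₃ r₁ r₂ r₃ r : ℝ} (h₁ : |x₁ - y₁| ≤ r₁)
    (h₂ : |x₂ - y₂| ≤ r₂) (h₃ : |x₃ - y₃| ≤ r₃) (h : (r₁ + r₂ + r₃) / 3 ≤ r) :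
    |(x₁ + x₂ + x₃) / 3 - (y₁ + y₂ + y₃) / 3| ≤ r := by
  rw [abs_le] at *
  constructor <;> linarith

theorem WeightedLipschitz.dyadicAvg {ε L M : ℝ} {g : C(ℤ_[2], ℝ)} (hg : WeightedLipschitz ε L M g)
    (hε : 0 ≤ ε) (hM : 0 ≤ M) (hL : M ≤ L * (11 / 12)) :
    WeightedLipschitz ε L M (dyadicAvg g) := by
  have hosc : ∀ a b, |_root_.dyadicAvg g a - _root_.dyadicAvg g b| ≤ M := by
    intro a b
    have key : ∀ x, _root_.dyadicAvg g a ≤ g x + M := fun x =>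
      dyadicAvg_le (fun y => by linarith [(abs_le.1 (hg.osc_le y x)).2]) a
    have key' : ∀ x, _root_.dyadicAvg g b ≤ g x + M := fun x =>
      dyadicAvg_le (fun y => by linarith [(abs_le.1 (hg.osc_le y x)).2]) b
    -- By `key`, the average at `a` minus `M` is a lower bound for `g`, hence also for the average
    -- at `b`.
    have h1 := le_dyadicAvg_pow (f := g) (s := _root_.dyadicAvg g a - M)
      (fun x => by linarith [key x]) 1 b
    have h2 := le_dyadicAvg_pow (f := g) (s := _root_.dyadicAvg g b - M)
      (fun x => by linarith [key' x]) 1 a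
    rw [pow_one] at h1 h2
    rw [abs_le]
    constructor <;> linarith
  refine ⟨hosc, ?_, ?_⟩
  · rintro k a b ha hab
    -- With no digit of agreement the oscillation bound must suffice; this is the role of `hL`.
    rcases k with - | k
    · rw [pow_zero]
      linarith [hosc a b]
    have hb : 2 ∣ b := (dvd_sub_right ha).1 ((Dvd.intro_left _ (pow_succ _ _).symm).trans hab)
    obtain ⟨a, rfl⟩ := ha
    obtain ⟨b, rfl⟩ := hb
    have hab' : (2 : ℤ_[2]) ^ k ∣ a - b := by
      rw [← mul_sub, pow_succ'] at hab
      exact (mul_dvd_mul_iff_left two_ne_zero).1 hab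
    have h4 : |g a - g b| ≤ ε + L * (3 / 4) ^ k := by
      have hp : 0 ≤ L * (3 / 4) ^ k := mul_nonneg (by linarith) (by positivity)
      by_cases h : 2 ∣ a
      · exact hg.of_even k a b h hab'
      · linarith [hg.of_odd k a b h hab']
    have h1 := hg.of_odd (k + 1) (2 * a + 1) (2 * b + 1)
      ((not_two_dvd_iff _).2 ⟨a + 1, by ring⟩)
      (by convert hab using 1; ring)
    have h2 := hg.of_odd (k + 1) (2 * a - 1) (2 * b - 1)
      ((not_two_dvd_iff _).2 ⟨a, by ring⟩) (by convert hab using 1; ring)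
    have h3 := hg.of_even (k + 2) (2 * (2 * a)) (2 * (2 * b)) (Dvd.intro _ rfl)
      (by rw [← mul_sub, pow_succ']; exact mul_dvd_mul_left 2 hab)
    rw [dyadicAvg_two_mul, dyadicAvg_two_mul]
    -- In units of `L * (3 / 4) ^ k` the mean is (2 · 11/16 + 9/16 + 1) / 4 = 47/64, just below the
    -- required 3/4. The discount 11/12 at the odd neighbours pays for the digit lost by halving.
    refine abs_avg_four_le h1 h2 h3 h4 ?_
    have hp : 0 ≤ L * (3 / 4) ^ k := mul_nonneg (by linarith) (by positivity)
    simp only [pow_succ]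
    linarith
  · rintro k a b ha hab
    rcases k with - | k
    · rw [pow_zero]
      linarith [hosc a b]
    have hb : ¬ 2 ∣ b := fun hb =>
      ha ((dvd_sub_left hb).1 ((Dvd.intro_left _ (pow_succ _ _).symm).trans hab))
    have ha1 := (not_two_dvd_iff a).1 ha
    have h1 := hg.of_even (k + 1) (a + 1) (b + 1) ha1 (by convert hab using 1; ring)
    have h2 := hg.of_even (k + 1) (a - 1) (b - 1)
      (by convert dvd_sub ha1 (dvd_refl 2) using 1; ring) (by convert hab using 1; ring)
    have h3 := hg.of_even (k + 2) (2 * a) (2 * b) (Dvd.intro _ rfl)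
      (by rw [← mul_sub, pow_succ']; exact mul_dvd_mul_left 2 hab)
    rw [dyadicAvg_of_not_dvd _ ha, dyadicAvg_of_not_dvd _ hb]
    -- In units of `L * (3 / 4) ^ (k + 1)` the mean is (1 + 1 + 3/4) / 3 = 11/12 exactly; this is
    -- where the odd weight comes from.
    refine abs_avg_three_le h1 h2 h3 ?_
    rw [pow_succ (3 / 4 : ℝ) (k + 1)]
    linarith

theorem exists_forall_dvd_sub_imp_abs_sub_lt (f : C(ℤ_[2], ℝ)) {ε : ℝ} (hε : 0 < ε) :
    ∃ k : ℕ, ∀ a b : ℤ_[2], 2 ^ k ∣ a - b → |f a - f b| < ε := by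
  obtain ⟨δ, hδ, h⟩ := Metric.uniformContinuous_iff.1
    (CompactSpace.uniformContinuous_of_continuous f.continuous) ε hε
  obtain ⟨k, hk⟩ := exists_pow_lt_of_lt_one hδ (by norm_num : (2 : ℝ)⁻¹ < 1)
  refine ⟨k, fun a b hab => h (lt_of_le_of_lt ?_ hk)⟩
  rw [dist_eq_norm]
  have := (PadicInt.norm_le_pow_iff_mem_span_pow (p := 2) (a - b) k).2
    (Ideal.mem_span_singleton.2 (by exact_mod_cast hab))
  simpa using this

/-- The iterates of a continuous function under the walk are equicontinuous. -/
theorem exists_forall_dyadicAvg_pow_abs_sub_le (f : C(ℤ_[2], ℝ)) {ε : ℝ} (hε : 0 < ε) :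
    ∃ k : ℕ, ∀ n : ℕ, ∀ a b : ℤ_[2], 2 ^ k ∣ a - b →
      |(dyadicAvg ^ n) f a - (dyadicAvg ^ n) f b| ≤ ε := by
  obtain ⟨K, hK⟩ := exists_forall_dvd_sub_imp_abs_sub_lt f (half_pos hε)
  set M := 2 * ‖f‖ with hM
  have hM0 : 0 ≤ M := by positivity
  have hosc : ∀ a b, |f a - f b| ≤ M := fun a b => by
    have h1 := f.norm_coe_le_norm a
    have h2 := f.norm_coe_le_norm b
    rw [Real.norm_eq_abs, abs_le] at h1 h2
    rw [abs_le]
    constructor <;> linarith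
  -- For `k ≤ K` this `L` makes the Lipschitz term at least `M`, so the oscillation bound suffices;
  -- for `k ≥ K` uniform continuity gives `ε / 2` alone.
  set L := M / ((3 / 4) ^ K * (11 / 12)) with hL
  have hpK : 0 < (3 / 4 : ℝ) ^ K := by positivity
  have hL0 : 0 ≤ L := by positivity
  have hLK : L * (3 / 4) ^ K * (11 / 12) = M := by
    rw [hL]
    field_simp
  have hodd : ∀ k a b, (2 : ℤ_[2]) ^ k ∣ a - b →
      |f a - f b| ≤ ε / 2 + L * (3 / 4) ^ k * (11 / 12) := by
    intro k a b hab
    rcases le_total K k with hk | hk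
    · have := hK a b ((pow_dvd_pow 2 hk).trans hab)
      have hp : 0 ≤ L * (3 / 4) ^ k * (11 / 12) := by positivity
      linarith
    · have hp : (3 / 4 : ℝ) ^ K ≤ (3 / 4) ^ k :=
        pow_le_pow_of_le_one (by norm_num) (by norm_num) hk
      have : L * (3 / 4) ^ K ≤ L * (3 / 4) ^ k := mul_le_mul_of_nonneg_left hp hL0
      linarith [hosc a b]
  have hf : WeightedLipschitz (ε / 2) L M f := by
    refine ⟨hosc, fun k a b _ hab => ?_, fun k a b _ hab => hodd k a b hab⟩
    have hp : 0 ≤ L * (3 / 4) ^ k := by positivity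
    linarith [hodd k a b hab]
  have hML : M ≤ L * (11 / 12) := by
    have : (3 / 4 : ℝ) ^ K ≤ 1 := pow_le_one₀ (by norm_num) (by norm_num)
    have : L * (3 / 4) ^ K ≤ L := mul_le_of_le_one_right hL0 this
    linarith
  have hn : ∀ n, WeightedLipschitz (ε / 2) L M ((dyadicAvg ^ n) f) := by
    intro n
    induction n with
    | zero => exact hf
    | succ n ih =>
      rw [dyadicAvg_pow_succ]
      exact ih.dyadicAvg (half_pos hε).le hM0 hML
  obtain ⟨k, hk⟩ := exists_pow_lt_of_lt_one (show 0 < ε / 2 / (L + 1) by positivity)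
    (by norm_num : (3 / 4 : ℝ) < 1)
  refine ⟨k, fun n a b hab => ?_⟩
  have hp : 0 < (3 / 4 : ℝ) ^ k := by positivity
  rw [lt_div_iff₀ (by positivity)] at hk
  by_cases h : 2 ∣ a
  · linarith [(hn n).of_even k a b h hab]
  · have := mul_nonneg hL0 hp.le
    linarith [(hn n).of_odd k a b h hab]

/-! ### Contraction of the iterates to constants. -/

theorem dyadicAvg_le_add_one {f : C(ℤ_[2], ℝ)} {s : ℝ} (h : ∀ a, f a ≤ s) (a : ℤ_[2]) :
    dyadicAvg f a ≤ (f (a + 1) + 3 * s) / 4 := by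
  by_cases ha : 2 ∣ a
  · obtain ⟨b, rfl⟩ := ha
    rw [dyadicAvg_two_mul]
    linarith [h (2 * b + 1), h (2 * b - 1), h (2 * (2 * b)), h b]
  · rw [dyadicAvg_of_not_dvd f ha]
    linarith [h (a + 1), h (a - 1), h (2 * a)]

theorem dyadicAvg_le_two_mul {f : C(ℤ_[2], ℝ)} {s : ℝ} (h : ∀ a, f a ≤ s) (a : ℤ_[2]) :
    dyadicAvg f a ≤ (f (2 * a) + 3 * s) / 4 := by
  by_cases ha : 2 ∣ a
  · obtain ⟨b, rfl⟩ := ha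
    rw [dyadicAvg_two_mul]
    linarith [h (2 * b + 1), h (2 * b - 1), h (2 * (2 * b)), h b]
  · rw [dyadicAvg_of_not_dvd f ha]
    linarith [h (a + 1), h (a - 1), h (2 * a)]

/-- Each prescribed move has probability at least 1/4. The path adds 1 until it enters 2^k ℤ₂, then
doubles, which stays there, to use up the remaining time. -/
theorem dyadicAvg_pow_le_of_dvd_add {f : C(ℤ_[2], ℝ)} {s t : ℝ} {k : ℕ} (hs : ∀ a, f a ≤ s)
    (ht : ∀ a, 2 ^ k ∣ a → f a ≤ t) (n j : ℕ) (hj : j ≤ n) (a : ℤ_[2]) (ha : 2 ^ k ∣ a + j) :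
    (dyadicAvg ^ n) f a ≤ s - (1 / 4) ^ n * (s - t) := by
  induction n generalizing j a with
  | zero =>
    obtain rfl : j = 0 := by omega
    have := ht a (by simpa using ha)
    simpa using this
  | succ n ih =>
    rw [dyadicAvg_pow_succ, pow_succ]
    rcases j with - | j
    · have h1 := dyadicAvg_le_two_mul (dyadicAvg_pow_le hs n) a
      have h2 := ih 0 (Nat.zero_le _) (2 * a) (by simpa using Dvd.dvd.mul_left (by simpa using ha) 2)
      linarith
    · have h1 := dyadicAvg_le_add_one (dyadicAvg_pow_le hs n) a
      have h2 := ih j (by omega) (a + 1) (by push_cast at ha; convert ha using 1; ring)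
      linarith

theorem dyadicAvg_pow_two_pow_le {f : C(ℤ_[2], ℝ)} {s t : ℝ} {k : ℕ} (hs : ∀ a, f a ≤ s)
    (ht : ∀ a, 2 ^ k ∣ a → f a ≤ t) (a : ℤ_[2]) :
    (dyadicAvg ^ (2 ^ k)) f a ≤ s - (1 / 4) ^ (2 ^ k) * (s - t) := by
  -- The residue of `-a` mod 2^k is the number of unit steps needed.
  refine dyadicAvg_pow_le_of_dvd_add hs ht _ ((-a).appr k) (PadicInt.appr_lt _ _).le a ?_
  have := Ideal.mem_span_singleton.1 (PadicInt.appr_spec k (-a))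
  rw [← dvd_neg]
  convert this using 1
  · norm_num
  · ring

/-- The iterates of a continuous function under the walk come uniformly close to constants. -/
theorem exists_dyadicAvg_pow_abs_sub_le (f : C(ℤ_[2], ℝ)) {r : ℝ} (hr : 0 < r) :
    ∃ (n : ℕ) (c : ℝ), ∀ a, |(dyadicAvg ^ n) f a - c| ≤ r := by
  set R : Set ℝ := {r | ∃ (n : ℕ) (c : ℝ), ∀ a, |(dyadicAvg ^ n) f a - c| ≤ r} with hR
  have hbdd : BddBelow R := ⟨0, fun r ⟨n, c, h⟩ => (abs_nonneg _).trans (h 0)⟩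
  have hne : R.Nonempty := ⟨‖f‖, 0, 0, fun a => by simpa using f.norm_coe_le_norm a⟩
  set r₀ := sInf R with hr₀
  have h0 : r₀ ≤ 0 := by
    by_contra! hpos
    obtain ⟨k, hk⟩ := exists_forall_dyadicAvg_pow_abs_sub_le f (half_pos hpos)
    set η : ℝ := (1 / 4) ^ (2 ^ k) with hη
    have hη0 : 0 < η := by positivity
    -- A further 2^k averagings bring the radius `r` to `r - η * r + η * (r₀ / 2)`. Since `r₀ ≤ r`,
    -- this is at most `r - η * r₀ / 2`, so the slack chosen here puts it below the infimum.
    obtain ⟨r, ⟨n, c, hc⟩, hlt⟩ := exists_lt_of_csInf_lt hne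
      (show sInf R < r₀ + η * r₀ / 2 by rw [← hr₀]; have := mul_pos hη0 hpos; linarith)
    set g := (dyadicAvg ^ n) f with hg
    have hkg : ∀ a, 2 ^ k ∣ a → |g a - g 0| ≤ r₀ / 2 := fun a ha =>
      hk n a 0 (by simpa using ha)
    have hup := dyadicAvg_pow_two_pow_le (f := g) (s := c + r) (t := g 0 + r₀ / 2) (k := k)
      (fun a => by linarith [(abs_le.1 (hc a)).2])
      (fun a ha => by linarith [(abs_le.1 (hkg a ha)).2])
    have hlo := dyadicAvg_pow_two_pow_le (f := -g) (s := r - c) (t := r₀ / 2 - g 0) (k := k)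
      (fun a => by rw [ContinuousMap.neg_apply]; linarith [(abs_le.1 (hc a)).1])
      (fun a ha => by rw [ContinuousMap.neg_apply]; linarith [(abs_le.1 (hkg a ha)).1])
    have hmem : r - η * r + η * (r₀ / 2) ∈ R := by
      refine ⟨2 ^ k + n, c - η * c + η * g 0, fun a => ?_⟩
      have h1 := hup a
      have h2 := hlo a
      rw [map_neg, ContinuousMap.neg_apply] at h2
      rw [pow_add, Module.End.mul_apply, ← hg, abs_le]
      constructor <;> linarith
    have hle := csInf_le hbdd hmem
    have hr0r : r₀ ≤ r := csInf_le hbdd ⟨n, c, hc⟩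
    rw [← hr₀] at hle
    have := mul_le_mul_of_nonneg_left hr0r hη0.le
    linarith
  obtain ⟨r', ⟨n, c, hc⟩, hlt⟩ := exists_lt_of_csInf_lt hne (h0.trans_lt hr)
  exact ⟨n, c, fun a => (hc a).trans hlt.le⟩

theorem dyadicAvg_pow_abs_sub_le_of_le {f : C(ℤ_[2], ℝ)} {n m : ℕ} {c r : ℝ}
    (h : ∀ a, |(dyadicAvg ^ n) f a - c| ≤ r) (hnm : n ≤ m) (a : ℤ_[2]) :
    |(dyadicAvg ^ m) f a - c| ≤ r := by
  obtain ⟨d, rfl⟩ := Nat.exists_eq_add_of_le' hnm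
  rw [pow_add, Module.End.mul_apply, abs_le]
  have h1 := dyadicAvg_pow_le (s := c + r) (fun x => by linarith [(abs_le.1 (h x)).2]) d a
  have h2 := le_dyadicAvg_pow (s := c - r) (fun x => by linarith [(abs_le.1 (h x)).1]) d a
  constructor <;> linarith

/-! ### The walk kernel and its dual action on measures. -/

theorem gammaStep_eq_of_dvd (b : ℤ_[2]) :
    gammaStep (2 * b) = (4⁻¹ : ENNReal) • (Measure.dirac (2 * b + 1) + Measure.dirac (2 * b - 1)
      + Measure.dirac (2 * (2 * b)) + Measure.dirac b) := by
  ext B hB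
  rw [gammaStep_even _ ⟨b, rfl⟩ B hB, dyadicHalf_two_mul]
  simp [Measure.dirac_apply' _ hB, mul_add]

theorem gammaStep_eq_of_not_dvd {a : ℤ_[2]} (ha : ¬ 2 ∣ a) :
    gammaStep a = (3⁻¹ : ENNReal) • (Measure.dirac (a + 1) + Measure.dirac (a - 1)
      + Measure.dirac (2 * a)) := by
  ext B hB
  rw [gammaStep_odd _ ((mem_range_two_mul_iff a).not.2 ha) B hB]
  simp [Measure.dirac_apply' _ hB, mul_add]

instance isMarkovKernel_gammaWalk : IsMarkovKernel gammaWalk := by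
  refine ⟨fun a => ⟨?_⟩⟩
  change gammaStep a Set.univ = 1
  by_cases ha : 2 ∣ a
  · obtain ⟨b, rfl⟩ := ha
    rw [gammaStep_eq_of_dvd]
    simp only [Measure.smul_apply, Measure.add_apply, measure_univ, smul_eq_mul]
    norm_num
    exact ENNReal.inv_mul_cancel (by norm_num) (by norm_num)
  · rw [gammaStep_eq_of_not_dvd ha]
    simp only [Measure.smul_apply, Measure.add_apply, measure_univ, smul_eq_mul]
    norm_num
    exact ENNReal.inv_mul_cancel (by norm_num) (by norm_num)

theorem integral_gammaWalk (f : C(ℤ_[2], ℝ)) (a : ℤ_[2]) :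
    ∫ x, f x ∂(gammaWalk a) = dyadicAvg f a := by
  change ∫ x, f x ∂(gammaStep a) = dyadicAvg f a
  have hd : ∀ b : ℤ_[2], Integrable f (Measure.dirac b) := fun b =>
    f.continuous.integrable_of_hasCompactSupport (HasCompactSupport.of_compactSpace f)
  by_cases ha : 2 ∣ a
  · obtain ⟨b, rfl⟩ := ha
    rw [gammaStep_eq_of_dvd, integral_smul_measure, integral_add_measure _ (hd _),
      integral_add_measure _ (hd _), integral_add_measure (hd _) (hd _), dyadicAvg_two_mul]
    · simp
      ring
    · exact (hd _).add_measure (hd _)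
    · exact ((hd _).add_measure (hd _)).add_measure (hd _)
  · rw [gammaStep_eq_of_not_dvd ha, integral_smul_measure, integral_add_measure _ (hd _),
      integral_add_measure (hd _) (hd _), dyadicAvg_of_not_dvd _ ha]
    · simp
      ring
    · exact (hd _).add_measure (hd _)

theorem integrable_continuousMap (f : C(ℤ_[2], ℝ)) (μ : Measure ℤ_[2]) [IsFiniteMeasure μ] :
    Integrable f μ :=
  f.continuous.integrable_of_hasCompactSupport (HasCompactSupport.of_compactSpace f)

theorem integral_bind_gammaWalk (f : C(ℤ_[2], ℝ)) (μ : Measure ℤ_[2]) [IsProbabilityMeasure μ] :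
    ∫ x, f x ∂(μ.bind gammaWalk) = ∫ x, dyadicAvg f x ∂μ := by
  have h := Kernel.integral_comp (κ := Kernel.const Unit μ) (η := gammaWalk) (a := ())
    (integrable_continuousMap f _)
  rw [Kernel.comp_apply, Kernel.const_apply] at h
  simp_rw [h, integral_gammaWalk]

theorem eq_of_forall_integral_continuousMap_eq {μ ν : Measure ℤ_[2]} [IsFiniteMeasure μ]
    [IsFiniteMeasure ν] (h : ∀ f : C(ℤ_[2], ℝ), ∫ x, f x ∂μ = ∫ x, f x ∂ν) : μ = ν :=
  ext_of_forall_integral_eq_of_IsFiniteMeasure fun f => h f.toContinuousMap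

theorem IsStationaryMeasure.integral_dyadicAvg_pow {μ : Measure ℤ_[2]}
    (hμ : IsStationaryMeasure μ) (f : C(ℤ_[2], ℝ)) (n : ℕ) :
    ∫ x, (dyadicAvg ^ n) f x ∂μ = ∫ x, f x ∂μ := by
  have := hμ.1
  induction n with
  | zero => rfl
  | succ n ih =>
    rw [dyadicAvg_pow_succ, ← integral_bind_gammaWalk, hμ.2.def, ih]

theorem abs_integral_sub_le {μ : Measure ℤ_[2]} [IsProbabilityMeasure μ] {g : C(ℤ_[2], ℝ)}
    {c r : ℝ} (h : ∀ a, |g a - c| ≤ r) : |∫ x, g x ∂μ - c| ≤ r := by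
  have := norm_integral_le_of_norm_le_const (μ := μ) (f := fun x => g x - c)
    (Filter.Eventually.of_forall h)
  rwa [integral_sub (integrable_continuousMap g μ) (integrable_const c), integral_const,
    probReal_univ, mul_one, one_smul] at this

/-! ### Uniqueness and existence. -/

theorem IsStationaryMeasure.eq {μ ν : Measure ℤ_[2]} (hμ : IsStationaryMeasure μ)
    (hν : IsStationaryMeasure ν) : μ = ν := by
  have := hμ.1
  have := hν.1
  refine eq_of_forall_integral_continuousMap_eq fun f => ?_
  refine eq_of_forall_dist_le fun ε hε => ?_
  obtain ⟨n, c, h⟩ := exists_dyadicAvg_pow_abs_sub_le f (half_pos hε)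
  have h1 := abs_integral_sub_le (μ := μ) h
  have h2 := abs_integral_sub_le (μ := ν) h
  rw [hμ.integral_dyadicAvg_pow, abs_le] at h1
  rw [hν.integral_dyadicAvg_pow, abs_le] at h2
  rw [Real.dist_eq, abs_le]
  constructor <;> linarith

/-- The law at time `n` of simple random walk started at `0`. -/
noncomputable def walkLaw : ℕ → ProbabilityMeasure ℤ_[2]
  | 0 => ⟨Measure.dirac 0, inferInstance⟩
  | n + 1 => ⟨(walkLaw n : Measure ℤ_[2]).bind gammaWalk, inferInstance⟩

theorem integral_walkLaw (n : ℕ) (f : C(ℤ_[2], ℝ)) :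
    ∫ x, f x ∂(walkLaw n : Measure ℤ_[2]) = (dyadicAvg ^ n) f 0 := by
  induction n generalizing f with
  | zero => exact integral_dirac f 0
  | succ n ih =>
    change ∫ x, f x ∂((walkLaw n : Measure ℤ_[2]).bind gammaWalk) = _
    rw [integral_bind_gammaWalk, ih, pow_succ]
    rfl

/-- Once an iterate is close to a constant, all later ones stay close to the same constant. This
makes a limit of the laws invariant without Cesàro averaging. -/
theorem tendsto_dyadicAvg_pow_succ_sub (f : C(ℤ_[2], ℝ)) :
    Filter.Tendsto (fun n => (dyadicAvg ^ (n + 1)) f 0 - (dyadicAvg ^ n) f 0) Filter.atTop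
      (nhds 0) := by
  rw [Metric.tendsto_atTop]
  intro ε hε
  obtain ⟨n, c, h⟩ := exists_dyadicAvg_pow_abs_sub_le f (show 0 < ε / 3 by positivity)
  refine ⟨n, fun m hm => ?_⟩
  have h1 := abs_le.1 (dyadicAvg_pow_abs_sub_le_of_le h hm 0)
  have h2 := abs_le.1 (dyadicAvg_pow_abs_sub_le_of_le h (hm.trans m.le_succ) 0)
  rw [dist_zero_right, Real.norm_eq_abs, abs_lt]
  constructor <;> linarith [h1.1, h1.2, h2.1, h2.2]

/-- The probability measures on the compact space ℤ₂ form a compact space, so the laws of the walk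
converge along a free ultrafilter. -/
theorem exists_isStationaryMeasure : ∃ ν, IsStationaryMeasure ν := by
  let U : Ultrafilter ℕ := Filter.hyperfilter ℕ
  have hU : (U : Filter ℕ) ≤ Filter.atTop := Nat.hyperfilter_le_atTop
  obtain ⟨ν, -, hν⟩ := isCompact_univ.ultrafilter_le_nhds (U.map walkLaw) (by simp)
  have ht : ∀ f : C(ℤ_[2], ℝ),
      Filter.Tendsto (fun n => (dyadicAvg ^ n) f 0) U (nhds (∫ x, f x ∂(ν : Measure ℤ_[2]))) := by
    intro f
    have := ProbabilityMeasure.tendsto_iff_forall_integral_tendsto.1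
      (show Filter.Tendsto walkLaw U (nhds ν) from hν) (BoundedContinuousFunction.mkOfCompact f)
    simpa [integral_walkLaw] using this
  refine ⟨ν, inferInstance, eq_of_forall_integral_continuousMap_eq fun f => ?_⟩
  rw [integral_bind_gammaWalk]
  refine tendsto_nhds_unique (ht (dyadicAvg f)) ?_
  have := ((tendsto_dyadicAvg_pow_succ_sub f).mono_left hU).add (ht f)
  rw [zero_add] at this
  refine this.congr fun n => ?_
  rw [sub_add_cancel, pow_succ]
  rfl

/-! ### Absence of atoms. -/

/-- The reciprocal of the degree of the root of `Γ a`. -/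
noncomputable def invDegree (a : ℤ_[2]) : ENNReal :=
  open Classical in if 2 ∣ a then 4⁻¹ else 3⁻¹

theorem invDegree_two_mul (a : ℤ_[2]) : invDegree (2 * a) = 4⁻¹ := if_pos (Dvd.intro a rfl)

theorem invDegree_of_not_dvd {a : ℤ_[2]} (ha : ¬ 2 ∣ a) : invDegree a = 3⁻¹ := if_neg ha

theorem invDegree_ne_zero (a : ℤ_[2]) : invDegree a ≠ 0 := by
  unfold invDegree
  split_ifs <;> simp

theorem invDegree_le_one (a : ℤ_[2]) : invDegree a ≤ 1 := by
  unfold invDegree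
  split_ifs <;> simp

/-- The four ways to arrive at `t` are kept as separate summands because they may share a source: at
`t = 0` doubling and halving both start from 0. -/
theorem gammaWalk_singleton (a t : ℤ_[2]) :
    gammaWalk a {t} = ({t - 1} : Set ℤ_[2]).indicator invDegree a
      + ({t + 1} : Set ℤ_[2]).indicator invDegree a
      + {b : ℤ_[2] | 2 * b = t}.indicator invDegree a
      + ({2 * t} : Set ℤ_[2]).indicator invDegree a := by
  classical
  change gammaStep a {t} = _
  have h1 : a + 1 = t ↔ a = t - 1 := eq_sub_iff_add_eq.symm
  have h2 : a - 1 = t ↔ a = t + 1 := sub_eq_iff_eq_add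
  by_cases ha : 2 ∣ a
  · obtain ⟨b, rfl⟩ := ha
    have h4 : b = t ↔ 2 * b = 2 * t := (mul_right_inj' two_ne_zero).symm
    rw [gammaStep_eq_of_dvd]
    simp only [Measure.smul_apply, Measure.add_apply, smul_eq_mul,
      Measure.dirac_apply' _ (measurableSet_singleton t), Set.indicator_apply,
      Set.mem_singleton_iff, h1, h2, h4, Pi.one_apply, invDegree_two_mul, Set.mem_ofPred_eq, mul_add,
      mul_ite, mul_one, mul_zero]
  · have h4 : a ≠ 2 * t := fun h => ha ⟨t, h⟩
    rw [gammaStep_eq_of_not_dvd ha]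
    simp only [Measure.smul_apply, Measure.add_apply, smul_eq_mul,
      Measure.dirac_apply' _ (measurableSet_singleton t), Set.indicator_apply,
      Set.mem_singleton_iff, h1, h2, h4, Pi.one_apply, invDegree_of_not_dvd ha, Set.mem_ofPred_eq,
      mul_add, mul_ite, mul_one, mul_zero, if_false, add_zero]

theorem measurable_invDegree : Measurable invDegree := by
  refine Measurable.ite ?_ measurable_const measurable_const
  have : {a : ℤ_[2] | 2 ∣ a} = Set.range (fun b : ℤ_[2] => 2 * b) := by
    ext a
    exact (mem_range_two_mul_iff a).symm
  rw [this]
  exact dyadic_two_mul_measurableEmbedding.measurableSet_range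

theorem lintegral_indicator_invDegree (ν : Measure ℤ_[2]) (x : ℤ_[2]) :
    ∫⁻ a, ({x} : Set ℤ_[2]).indicator invDegree a ∂ν = invDegree x * ν {x} := by
  rw [lintegral_indicator (measurableSet_singleton x), lintegral_singleton]

theorem IsStationaryMeasure.measure_singleton {ν : Measure ℤ_[2]} (hν : IsStationaryMeasure ν)
    (t : ℤ_[2]) :
    ν {t} = invDegree (t - 1) * ν {t - 1} + invDegree (t + 1) * ν {t + 1}
      + ∫⁻ a, {b : ℤ_[2] | 2 * b = t}.indicator invDegree a ∂ν
      + invDegree (2 * t) * ν {2 * t} := by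
  have hs : MeasurableSet {b : ℤ_[2] | 2 * b = t} :=
    dyadic_two_mul_measurableEmbedding.measurable (measurableSet_singleton t)
  have hm := fun x : ℤ_[2] => measurable_invDegree.indicator (measurableSet_singleton x)
  have hm' := measurable_invDegree.indicator hs
  conv_lhs => rw [← hν.2.def, Measure.bind_apply (measurableSet_singleton t)
    gammaWalk.measurable.aemeasurable]
  simp_rw [gammaWalk_singleton]
  rw [lintegral_add_right _ (hm _), lintegral_add_right _ hm', lintegral_add_right _ (hm _)]
  simp only [lintegral_indicator_invDegree]

/-- The mass of an atom divided by the degree of the root is harmonic, hence constant along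
translates of a point where it is maximal. -/
theorem IsStationaryMeasure.invDegree_mul_measure_add_one {ν : Measure ℤ_[2]}
    (hν : IsStationaryMeasure ν) {x : ℤ_[2]}
    (hx : ∀ y, invDegree y * ν {y} ≤ invDegree x * ν {x}) :
    invDegree (x + 1) * ν {x + 1} = invDegree x * ν {x} := by
  have := hν.1
  have hfin : ∀ y, invDegree y * ν {y} ≠ ⊤ := fun y =>
    ENNReal.mul_ne_top ((invDegree_le_one y).trans_lt ENNReal.one_lt_top).ne (measure_ne_top ν _)
  set h : ℤ_[2] → ℝ := fun y => (invDegree y * ν {y}).toReal with hh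
  have hle : ∀ y, h y ≤ h x := fun y => ENNReal.toReal_mono (hfin x) (hx y)
  suffices h x ≤ h (x + 1) from
    (hx _).antisymm ((ENNReal.toReal_le_toReal (hfin _) (hfin _)).1 this)
  have key := hν.measure_singleton x
  by_cases hd : 2 ∣ x
  · obtain ⟨b, rfl⟩ := hd
    have hset : {c : ℤ_[2] | 2 * c = 2 * b} = {b} := by
      ext c
      simp
    rw [hset, lintegral_indicator_invDegree] at key
    have key' := congrArg ENNReal.toReal key
    rw [ENNReal.toReal_add (by simp [hfin]) (hfin _), ENNReal.toReal_add (by simp [hfin]) (hfin _),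
      ENNReal.toReal_add (hfin _) (hfin _)] at key'
    have hdeg : h (2 * b) = 4⁻¹ * (ν {2 * b}).toReal := by
      simp [hh, invDegree_two_mul]
    -- Stationarity says that four times the value at `2 * b` is the sum of the four neighbouring
    -- values. Three of these are at most the maximum, so the fourth attains it.
    have h1 := hle (2 * b - 1)
    have h2 := hle b
    have h3 := hle (2 * (2 * b))
    simp only [hh] at *
    linarith
  · have hset : {c : ℤ_[2] | 2 * c = x} = ∅ := by
      ext c
      simpa using fun hc : 2 * c = x => hd ⟨c, hc.symm⟩
    rw [hset] at key
    simp only [Set.indicator_empty, lintegral_zero, add_zero] at key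
    have key' := congrArg ENNReal.toReal key
    rw [ENNReal.toReal_add (by simp [hfin]) (hfin _), ENNReal.toReal_add (hfin _) (hfin _)] at key'
    have hdeg : h x = 3⁻¹ * (ν {x}).toReal := by
      simp [hh, invDegree_of_not_dvd hd]
    have h1 := hle (x - 1)
    have h3 := hle (2 * x)
    simp only [hh] at *
    linarith

theorem IsStationaryMeasure.measure_singleton_eq_zero {ν : Measure ℤ_[2]}
    (hν : IsStationaryMeasure ν) (a : ℤ_[2]) : ν {a} = 0 := by
  have := hν.1
  by_contra ha
  set h : ℤ_[2] → ENNReal := fun y => invDegree y * ν {y} with hh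
  have hpos : 0 < h a := pos_iff_ne_zero.2 (mul_ne_zero (invDegree_ne_zero a) ha)
  -- A finite measure has only finitely many atoms above a positive threshold, so `h` attains its
  -- maximum.
  have hfin : {y | h a ≤ h y}.Finite := by
    refine (Measure.finite_const_le_meas_of_disjoint_iUnion ν hpos
      (As := fun y : ℤ_[2] => {y}) measurableSet_singleton
      (fun x y hxy => Set.disjoint_singleton.2 hxy) (measure_ne_top ν _)).subset fun y hy => ?_
    exact le_trans (α := ENNReal) hy (mul_le_of_le_one_left' (invDegree_le_one y))
  obtain ⟨x, hxa, hx⟩ := Set.exists_max_image _ h hfin ⟨a, le_refl (h a)⟩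
  have hmax : ∀ y, h y ≤ h x := fun y =>
    (le_total (h a) (h y)).elim (hx y) fun hy => hy.trans hxa
  have htrans : ∀ n : ℕ, h (x + n) = h x := by
    intro n
    induction n with
    | zero => simp
    | succ n ih =>
      rw [← ih, Nat.cast_succ, ← add_assoc]
      exact hν.invDegree_mul_measure_add_one fun y => (hmax y).trans_eq ih.symm
  refine Set.infinite_of_injective_forall_mem (f := fun n : ℕ => x + (n : ℤ_[2]))
    (fun m n hmn => Nat.cast_injective (add_left_cancel hmn)) (fun n => ?_) hfin
  exact le_of_le_of_eq hxa (htrans n).symm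

theorem theoremt :
    (∃! ν : Measure ℤ_[2], IsStationaryMeasure ν) ∧
      ∀ ν : Measure ℤ_[2], IsStationaryMeasure ν → ∀ a : ℤ_[2], ν {a} = 0 := by
  obtain ⟨ν, hν⟩ := exists_isStationaryMeasure
  exact ⟨⟨ν, hν, fun μ hμ => hμ.eq hν⟩, fun μ hμ a => hμ.measure_singleton_eq_zero a⟩
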